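/- Let $X$ be a connected Riemannian manifold (possibly with boundary or corners) of dimension $D\ge 1$, with Riemannian distance $d$ and Riemannian volume $m$, and let $\mu$ be a Borel probability measure on $X$ with a density $h=\frac{d\mu}{dm}$. Let $T:X\to X$ be an ergodic $\mu$-preserving map. Assume: (A) there are constants $C$ and $0<\theta<1$ such that for all bounded Lipschitz functions $\varphi,\psi:X\to\mathbb R$ and all integers $j\ge 0$, $$\Big|\int \varphi\cdot\psi\circ T^j\,d\mu-\int\varphi\,d\mu\int\psi\,d\mu\Big|\le C\theta^j\|\varphi\|_{\mathrm{Lip}}\|\psi\|_{\mathrm{Lip}},$$ where $\|\varphi\|_{\mathrm{Lip}}=\sup|\varphi|+\mathrm{Lip}(\varphi)$; (B) there are $r_0>0$ and $0<\delta<1$ such that $\mu\{x: r<d(x,q)<r+\varepsilon\}<\varepsilon^\delta$ for all $q\in X$ and all $0<\varepsilon<r\le r_0$. Let $p\in X$ be a point at which the density $h$ lies between two positive constants, in the sense that for some $0<C_1\le C_2<\infty$ and all sufficiently small $r>0$ the average of $h$ with respect to $m$ over the ball of radius $r$ about $p$ lies in $[C_1,C_2]$. For $k\in\mathbb R$ let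 $\phi(x)=d(x,p)^{-k}$ (with $\phi(p)=\infty$ if $k>0$) and $S_n=\sum_{j=0}^{n-1}\phi\circ T^j$. If $k>D$, then for every $\epsilon>0$, for $\mu$-a.e. $x$, $$\limsup_{n\to\infty}\frac{S_n(x)}{n^{k/D}(\log n)^{k/D+\epsilon}}=0\qquad\text{and}\qquad \liminf_{n\to\infty}\frac{S_n(x)}{n^{k/D}\big(e^{-(\log n)^{1/2+\epsilon}}\big)^{k/D}}>1 .$$ If $k=D$, then there is a constant $a>0$ such that $\liminf_{n\to\infty}\frac{S_n(x)}{n}>a$ for $\mu$-a.e. $x$. -/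

import Mathlib

open MeasureTheory Filter Topology Bundle
open scoped ENNReal NNReal Manifold

noncomputable section

/-- The Lipschitz norm `‖f‖_Lip = sup |f| + Lip(f)` of a bounded Lipschitz function `f`, where
`Lip(f)` is the smallest Lipschitz constant of `f`. It is only used for functions that are bounded
and Lipschitz. -/
def lipNorm {X : Type*} [MetricSpace X] (f : X → ℝ) : ℝ :=
  (⨆ x, |f x|) + sInf {K : ℝ | 0 ≤ K ∧ ∀ x y, |f x - f y| ≤ K * dist x y}

/-- Functions of finite Lipschitz norm: bounded Lipschitz functions. -/
def IsBddLipschitz {X : Type*} [MetricSpace X] (f : X → ℝ) : Prop :=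
  (∃ K : ℝ≥0, LipschitzWith K f) ∧ ∃ M : ℝ, ∀ x, |f x| ≤ M

/-- Condition (A), exponential decay of correlations for Lipschitz functions:
`|E(φ · ψ ∘ T^j) - E(φ) E(ψ)| ≤ C θ^j ‖φ‖_Lip ‖ψ‖_Lip`. -/
def ExpDecayLipschitz {X : Type*} [MetricSpace X] [MeasurableSpace X]
    (T : X → X) (μ : Measure X) : Prop :=
  ∃ C θ : ℝ, 0 < θ ∧ θ < 1 ∧
    ∀ φ ψ : X → ℝ, IsBddLipschitz φ → IsBddLipschitz ψ → ∀ j : ℕ,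
      |(∫ x, φ x * ψ (T^[j] x) ∂μ) - (∫ x, φ x ∂μ) * ∫ x, ψ x ∂μ|
        ≤ C * θ ^ j * lipNorm φ * lipNorm ψ

/-- Condition (B), the measure of thin annuli: `μ {x | r < d(x,q) < r + ε} < ε^δ` for all points
`q` and all `0 < ε < r ≤ r₀`. -/
def ThinAnnuli {X : Type*} [MetricSpace X] [MeasurableSpace X] (μ : Measure X) : Prop :=
  ∃ r₀ δ : ℝ, 0 < r₀ ∧ 0 < δ ∧ δ < 1 ∧
    ∀ q : X, ∀ ε r : ℝ, 0 < ε → ε < r → r ≤ r₀ →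
      μ {x | r < dist x q ∧ dist x q < r + ε} < ENNReal.ofReal (ε ^ δ)

/-- The density `h` with respect to `m` lies at the point `p` between two positive constants.
As `h` is only determined almost everywhere, its value at `p` is read through its averages over
small balls about `p`. This holds in particular if `h` is a.e. between two positive constants on a
neighbourhood of `p`, or if `h` is continuous at `p` with `0 < h p < ∞`. -/
def DensityBoundedAt {X : Type*} [MetricSpace X] [MeasurableSpace X]
    (m : Measure X) (h : X → ℝ≥0∞) (p : X) : Prop :=
  ∃ C₁ C₂ : ℝ, 0 < C₁ ∧ ∀ᶠ r : ℝ in 𝓝[>] 0,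
    ENNReal.ofReal C₁ ≤ (⨍⁻ x in Metric.ball p r, h x ∂m) ∧
      (⨍⁻ x in Metric.ball p r, h x ∂m) ≤ ENNReal.ofReal C₂

/-- The observable `φ(x) = d(x,p)^{-k}`, with `φ(p) = ∞` for `k > 0`. -/
def poleObservable {X : Type*} [MetricSpace X] (p : X) (k : ℝ) (x : X) : ℝ≥0∞ :=
  edist x p ^ (-k)

/-- The Birkhoff sum `S_n = ∑_{j=0}^{n-1} φ ∘ T^j`. -/
def birkhoffS {X : Type*} (T : X → X) (φ : X → ℝ≥0∞) (n : ℕ) (x : X) : ℝ≥0∞ :=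
  ∑ j ∈ Finset.range n, φ (T^[j] x)

end

/-!
In charts the Riemannian distance is comparable to a norm, so the `μ`-measure of the ball of radius
`r` about `p` is comparable to `r ^ D`; on the boundary this uses the convexity of the model.

Upper bound: the upper half of this estimate places `φ` in weak `L^s` with `s = D / k < 1`. For a
normalizer `c` with `∑ (c n)^(-s) < ∞`, the sum `∑ min (φ ∘ T^n / c n) 1` has finite integral, and
dominated convergence for the counting measure turns its almost sure convergence into
`S_n = o(c n)`.

Lower bounds: correlations between Lipschitz bumps decay exponentially, so the variance of the
number of visits to a ball up to time `n` is that of a sum of variables independent at distance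
`log n`. By Chebyshev's inequality and the Borel–Cantelli lemma along `n = 2 ^ i`, orbits visit a
fixed ball with positive frequency, and enter the ball of radius `(i ^ 3 / 2 ^ i) ^ (1 / D)` before
time `2 ^ i`; one such visit already contributes enough to `S_n`.
-/

section PathLength

open Set Metric Manifold

attribute [local instance] normedAddCommGroupTangentSpaceVectorSpace
  normedSpaceTangentSpaceVectorSpace

section ENorm

variable {E : Type*} [NormedAddCommGroup E] [NormedSpace ℝ E]
  {H : Type*} [TopologicalSpace H] {I : ModelWithCorners ℝ E H}
  {M : Type*} [TopologicalSpace M] [ChartedSpace H M] [∀ x : M, ENorm (TangentSpace I x)]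
  {E' : Type*} [NormedAddCommGroup E'] [NormedSpace ℝ E']
  {H' : Type*} [TopologicalSpace H'] {I' : ModelWithCorners ℝ E' H'}
  {M' : Type*} [TopologicalSpace M'] [ChartedSpace H' M'] [∀ x : M', ENorm (TangentSpace I' x)]

lemma pathELength_comp_le {f : M → M'} {s : Set M} {C : ℝ≥0} {γ : ℝ → M} {a b : ℝ} (hab : a < b)
    (hf : MDifferentiableOn I I' f s)
    (hC : ∀ x ∈ s, ∀ v : TangentSpace I x, ‖mfderivWithin I I' f s x v‖ₑ ≤ C * ‖v‖ₑ)
    (hγ : MDifferentiableOn 𝓘(ℝ) I γ (Icc a b)) (hγs : MapsTo γ (Icc a b) s) :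
    pathELength I' (f ∘ γ) a b ≤ C * pathELength I γ a b := by
  rw [pathELength_eq_lintegral_mfderivWithin_Icc, pathELength_eq_lintegral_mfderivWithin_Icc,
    ← lintegral_const_mul' _ _ ENNReal.coe_ne_top]
  refine setLIntegral_mono' measurableSet_Icc fun t ht => ?_
  have chain_rule : mfderivWithin 𝓘(ℝ) I' (f ∘ γ) (Icc a b) t =
      (mfderivWithin I I' f s (γ t)).comp (mfderivWithin 𝓘(ℝ) I γ (Icc a b) t) :=
    mfderivWithin_comp t (hf _ (hγs ht)) (hγ t ht) hγs
      (uniqueMDiffWithinAt_iff_uniqueDiffWithinAt.2 (uniqueDiffOn_Icc hab t ht))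
  rw [chain_rule]
  exact hC _ (hγs ht) _

end ENorm

section VectorSpace

variable {E : Type*} [NormedAddCommGroup E] [NormedSpace ℝ E]

lemma edist_le_pathELength_vectorSpace {γ : ℝ → E} {a b : ℝ} (hab : a ≤ b)
    (hγ : ContMDiffOn 𝓘(ℝ) 𝓘(ℝ, E) 1 γ (Icc a b)) :
    edist (γ a) (γ b) ≤ pathELength 𝓘(ℝ, E) γ a b := by
  rw [edist_comm, edist_eq_enorm_sub, pathELength_eq_lintegral_mfderivWithin_Icc]
  refine (enorm_sub_le_lintegral_derivWithin_Icc_of_contDiffOn_Icc hγ.contDiffOn hab).trans_eq ?_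
  simp_rw [← fderivWithin_derivWithin, mfderivWithin_eq_fderivWithin]
  rfl

lemma pathELength_lineMap (u v : E) :
    pathELength 𝓘(ℝ, E) (AffineMap.lineMap u v : ℝ → E) 0 1 = edist u v := by
  rw [pathELength_eq_lintegral_mfderivWithin_Icc, ← lintegral_fderiv_lineMap_eq_edist]
  simp only [mfderivWithin_eq_fderivWithin]
  rfl

end VectorSpace

variable {E : Type*} [NormedAddCommGroup E] [NormedSpace ℝ E]
  {H : Type*} [TopologicalSpace H] {I : ModelWithCorners ℝ E H}
  {M : Type*} [PseudoEMetricSpace M] [ChartedSpace H M]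
  [RiemannianBundle (fun x : M => TangentSpace I x)] [IsRiemannianManifold I M]
  {F : Type*} [NormedAddCommGroup F] [NormedSpace ℝ F]

lemma edist_le_pathELength {γ : ℝ → M} {a b : ℝ} (hab : a ≤ b)
    (hγ : ContMDiffOn 𝓘(ℝ) I 1 γ (Icc a b)) :
    edist (γ a) (γ b) ≤ pathELength I γ a b := by
  rw [IsRiemannianManifold.out (I := I)]
  exact riemannianEDist_le_pathELength hγ rfl rfl hab

lemma lipschitzOnWith_of_convex_of_enorm_mfderivWithin_le {f : F → M} {s : Set F} {C : ℝ≥0}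
    (hs : Convex ℝ s) (hf : ContMDiffOn 𝓘(ℝ, F) I 1 f s)
    (hC : ∀ x ∈ s, ∀ v : TangentSpace 𝓘(ℝ, F) x,
      ‖mfderivWithin 𝓘(ℝ, F) I f s x v‖ₑ ≤ C * ‖v‖ₑ) :
    LipschitzOnWith C f s := by
  intro u hu v hv
  have line_smooth : ContMDiff 𝓘(ℝ) 𝓘(ℝ, F) 1 (AffineMap.lineMap u v : ℝ → F) :=
    (ContinuousAffineMap.lineMap (R := ℝ) u v).contDiff.contMDiff
  have line_mem : MapsTo (AffineMap.lineMap u v : ℝ → F) (Icc 0 1) s :=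
    fun t ht => hs.lineMap_mem hu hv ht
  calc edist (f u) (f v)
    _ = edist ((f ∘ AffineMap.lineMap u v) (0 : ℝ)) ((f ∘ AffineMap.lineMap u v) (1 : ℝ)) := by
      simp
    _ ≤ pathELength I (f ∘ AffineMap.lineMap u v) 0 1 :=
      edist_le_pathELength zero_le_one
        (hf.comp line_smooth.contMDiffOn line_mem)
    _ ≤ C * pathELength 𝓘(ℝ, F) (AffineMap.lineMap u v : ℝ → F) 0 1 :=
      pathELength_comp_le zero_lt_one (hf.mdifferentiableOn one_ne_zero) hC
        (line_smooth.mdifferentiable one_ne_zero).mdifferentiableOn line_mem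
    _ = C * edist u v := by rw [pathELength_lineMap]

lemma exists_pathELength_lt_mapsTo_eball {x y : M} {ℓ : ℝ≥0∞} (hxy : edist x y < ℓ) :
    ∃ γ : ℝ → M, γ 0 = x ∧ γ 1 = y ∧ ContMDiffOn 𝓘(ℝ) I 1 γ (Icc 0 1) ∧
      pathELength I γ 0 1 < ℓ ∧ MapsTo γ (Icc 0 1) (eball x ℓ) := by
  rw [IsRiemannianManifold.out (I := I)] at hxy
  obtain ⟨γ, rfl, rfl, hγ, hlen⟩ := exists_lt_of_riemannianEDist_lt hxy
  refine ⟨γ, rfl, rfl, hγ, hlen, fun t ht => ?_⟩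
  calc edist (γ t) (γ 0)
    _ = edist (γ 0) (γ t) := edist_comm _ _
    _ ≤ pathELength I γ 0 t := edist_le_pathELength ht.1 (hγ.mono (Icc_subset_Icc_right ht.2))
    _ ≤ pathELength I γ 0 1 := pathELength_mono le_rfl ht.2
    _ < ℓ := hlen

lemma edist_le_of_enorm_mfderivWithin_le {f : M → F} {s : Set M} {C : ℝ≥0} {x y : M} {r : ℝ≥0∞}
    (hf : ContMDiffOn I 𝓘(ℝ, F) 1 f s)
    (hC : ∀ z ∈ s, ∀ v : TangentSpace I z, ‖mfderivWithin I 𝓘(ℝ, F) f s z v‖ₑ ≤ C * ‖v‖ₑ)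
    (hxy : edist x y < r) (hr : eball x r ⊆ s) :
    edist (f x) (f y) ≤ C * edist x y := by
  have le_mul_of_lt : ∀ ℓ ∈ Ioo (edist x y) r, edist (f x) (f y) ≤ C * ℓ := by
    rintro ℓ ⟨hℓ, hℓr⟩
    obtain ⟨γ, rfl, rfl, hγ, hlen, hmaps⟩ := exists_pathELength_lt_mapsTo_eball (I := I) hℓ
    have hγs : MapsTo γ (Icc 0 1) s := hmaps.mono_right ((eball_subset_eball hℓr.le).trans hr)
    calc edist (f (γ 0)) (f (γ 1))
      _ ≤ pathELength 𝓘(ℝ, F) (f ∘ γ) 0 1 :=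
        edist_le_pathELength_vectorSpace zero_le_one (hf.comp hγ hγs)
      _ ≤ C * pathELength I γ 0 1 :=
        pathELength_comp_le zero_lt_one (hf.mdifferentiableOn one_ne_zero) hC
          (hγ.mdifferentiableOn one_ne_zero) hγs
      _ ≤ C * ℓ := by gcongr
  have : (𝓝[>] edist x y).NeBot := nhdsGT_neBot_of_exists_gt ⟨r, hxy⟩
  exact ge_of_tendsto (ENNReal.Tendsto.const_mul (tendsto_id.mono_left nhdsWithin_le_nhds)
    (Or.inr ENNReal.coe_ne_top)) (eventually_of_mem (Ioo_mem_nhdsGT hxy) le_mul_of_lt)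

lemma exists_mem_nhds_lipschitzOnWith_of_enorm_mfderivWithin_le {f : M → F} {s : Set M} {C : ℝ≥0}
    {p : M} (hs : s ∈ 𝓝 p) (hf : ContMDiffOn I 𝓘(ℝ, F) 1 f s)
    (hC : ∀ z ∈ s, ∀ v : TangentSpace I z, ‖mfderivWithin I 𝓘(ℝ, F) f s z v‖ₑ ≤ C * ‖v‖ₑ) :
    ∃ t ∈ 𝓝 p, LipschitzOnWith C f t := by
  obtain ⟨r, r_pos, hr⟩ := EMetric.mem_nhds_iff.1 hs
  refine ⟨eball p (r / 3), eball_mem_nhds p (ENNReal.div_pos r_pos.ne' (by simp)),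
    fun x hx y hy => edist_le_of_enorm_mfderivWithin_le (r := r / 3 + r / 3) hf hC ?_ ?_⟩
  · exact (edist_triangle_right x y p).trans_lt (ENNReal.add_lt_add hx hy)
  · refine (eball_subset ?_ (hx.trans_le le_top).ne).trans hr
    calc edist x p + (r / 3 + r / 3)
      _ ≤ r / 3 + (r / 3 + r / 3) := by gcongr; exact (mem_eball.1 hx).le
      _ = r := by rw [← add_assoc, ENNReal.add_thirds]

variable [IsManifold I 1 M] [IsContinuousRiemannianBundle E (fun x : M => TangentSpace I x)]

lemma exists_lipschitzOnWith_extChartAt (p : M) :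
    ∃ C : ℝ≥0, 0 < C ∧ ∃ s ∈ 𝓝 p, LipschitzOnWith C (extChartAt I p) s := by
  obtain ⟨C, C_pos, hC⟩ := eventually_enorm_mfderiv_extChartAt_lt I p
  obtain ⟨U, hU, U_open, hpU⟩ :=
    eventually_nhds_iff.1 (hC.and (extChartAt_source_mem_nhds (I := I) p))
  refine ⟨C, C_pos, exists_mem_nhds_lipschitzOnWith_of_enorm_mfderivWithin_le (U_open.mem_nhds hpU)
    (contMDiffOn_extChartAt.mono fun x hx => extChartAt_source I p ▸ (hU x hx).2) fun x hx v => ?_⟩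
  rw [mfderivWithin_of_isOpen U_open hx]
  exact (ContinuousLinearMap.le_opENorm _ v).trans (by gcongr; exact (hU x hx).1.le)

lemma exists_lipschitzOnWith_extChartAt_symm (p : M) :
    ∃ C : ℝ≥0, 0 < C ∧ ∃ s ∈ 𝓝[range I] (extChartAt I p p),
      LipschitzOnWith C (extChartAt I p).symm s := by
  obtain ⟨C, C_pos, hC⟩ := eventually_enorm_mfderivWithin_symm_extChartAt_lt I p
  obtain ⟨r, r_pos, hr⟩ :=
    mem_nhdsWithin_iff.1 (inter_mem hC (extChartAt_target_mem_nhdsWithin (I := I) p))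
  refine ⟨C, C_pos, range I ∩ ball (extChartAt I p p) r,
    inter_mem_nhdsWithin _ (ball_mem_nhds _ r_pos),
    lipschitzOnWith_of_convex_of_enorm_mfderivWithin_le (I.convex_range.inter (convex_ball _ _))
      ((contMDiffOn_extChartAt_symm p).mono fun y hy => (hr hy.symm).2) fun y hy v => ?_⟩
  rw [mfderivWithin_inter (isOpen_ball.mem_nhds hy.2)]
  exact (ContinuousLinearMap.le_opENorm _ v).trans (by gcongr; exact (hr hy.symm).1.le)

end PathLength

section Regularity

open Set Metric

/-- The measure `μ` is lower Ahlfors regular of exponent `d` at the point `p`: small balls about `p`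
have measure at least a positive constant times the `d`-th power of their radius. -/
def LowerRegularAt {X : Type*} [PseudoMetricSpace X] [MeasurableSpace X]
    (μ : Measure X) (d : ℝ) (p : X) : Prop :=
  ∃ c : ℝ≥0, 0 < c ∧ ∀ᶠ r : ℝ in 𝓝[>] 0, c * ENNReal.ofReal (r ^ d) ≤ μ (ball p r)

/-- The measure `μ` is upper Ahlfors regular of exponent `d` at the point `p`: small balls about `p`
have measure at most a constant times the `d`-th power of their radius. -/
def UpperRegularAt {X : Type*} [PseudoMetricSpace X] [MeasurableSpace X]
    (μ : Measure X) (d : ℝ) (p : X) : Prop :=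
  ∃ C : ℝ≥0, ∀ᶠ r : ℝ in 𝓝[>] 0, μ (ball p r) ≤ C * ENNReal.ofReal (r ^ d)

section BallComparison

variable {X Y : Type*} [PseudoMetricSpace X] [MeasurableSpace X] [PseudoMetricSpace Y]
  [MeasurableSpace Y] {μ : Measure X} {ν : Measure Y} {d : ℝ} {p : X} {q : Y} {A : ℝ≥0} {B : ℝ}

lemma UpperRegularAt.of_ball_le (h : UpperRegularAt ν d q) (hB : 0 < B)
    (hle : ∀ᶠ r : ℝ in 𝓝[>] 0, μ (ball p r) ≤ A * ν (ball q (B * r))) :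
    UpperRegularAt μ d p := by
  obtain ⟨C, hC⟩ := h
  refine ⟨A * C * (B ^ d).toNNReal, ?_⟩
  filter_upwards [hle, eventually_nhdsGT_zero_mul_left hB hC, self_mem_nhdsWithin]
    with r hr hCr (r_pos : 0 < r)
  calc μ (ball p r)
    _ ≤ A * ν (ball q (B * r)) := hr
    _ ≤ A * (C * ENNReal.ofReal ((B * r) ^ d)) := by gcongr
    _ = (A * C * (B ^ d).toNNReal : ℝ≥0) * ENNReal.ofReal (r ^ d) := by
      rw [Real.mul_rpow hB.le r_pos.le, ENNReal.ofReal_mul (by positivity)]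
      push_cast
      rw [ENNReal.ofReal]
      ring

lemma LowerRegularAt.of_ball_le (h : LowerRegularAt ν d q) (hB : 0 < B)
    (hle : ∀ᶠ r : ℝ in 𝓝[>] 0, ν (ball q r) ≤ A * μ (ball p (B * r))) :
    LowerRegularAt μ d p := by
  obtain ⟨c, c_pos, hc⟩ := h
  have B_inv_pos : 0 < B⁻¹ := inv_pos.2 hB
  refine ⟨c * (B⁻¹ ^ d).toNNReal / (A + 1), by positivity, ?_⟩
  filter_upwards [eventually_nhdsGT_zero_mul_left B_inv_pos (hle.and hc), self_mem_nhdsWithin]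
    with r ⟨hr, hcr⟩ (r_pos : 0 < r)
  rw [mul_inv_cancel_left₀ hB.ne'] at hr
  rw [ENNReal.coe_div (by positivity), ENNReal.mul_comm_div, mul_div_assoc']
  refine ENNReal.div_le_of_le_mul' ?_
  calc ((c * (B⁻¹ ^ d).toNNReal : ℝ≥0) : ℝ≥0∞) * ENNReal.ofReal (r ^ d)
    _ = c * ENNReal.ofReal ((B⁻¹ * r) ^ d) := by
      rw [Real.mul_rpow B_inv_pos.le r_pos.le, ENNReal.ofReal_mul (by positivity),
        ENNReal.coe_mul, mul_assoc, ENNReal.ofNNReal_toNNReal]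
    _ ≤ A * μ (ball p r) := hcr.trans hr
    _ ≤ (A + 1 : ℝ≥0) * μ (ball p r) := by gcongr; exact le_self_add

end BallComparison

section Density

variable {X : Type*} [MetricSpace X] [MeasurableSpace X] [OpensMeasurableSpace X] {m : Measure X}
  {h : X → ℝ≥0∞} {d : ℝ} {p : X}

lemma UpperRegularAt.withDensity (hm : UpperRegularAt m d p) (hp : DensityBoundedAt m h p) :
    UpperRegularAt (m.withDensity h) d p := by
  obtain ⟨_, C, -, hC⟩ := hp
  refine hm.of_ball_le (A := C.toNNReal) one_pos ?_
  obtain ⟨C', hC'⟩ := hm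
  filter_upwards [hC, hC'] with r havg hr
  have finite : m (ball p r) ≠ ∞ := (hr.trans_lt (by finiteness)).ne
  rw [withDensity_apply _ measurableSet_ball, one_mul]
  rw [setLAverage_eq] at havg
  exact (ENNReal.div_le_iff_le_mul (.inr ENNReal.ofReal_ne_top) (.inl finite)).1 havg.2

lemma LowerRegularAt.withDensity (hm : LowerRegularAt m d p) (hp : DensityBoundedAt m h p) :
    LowerRegularAt (m.withDensity h) d p := by
  obtain ⟨C, _, C_pos, hC⟩ := hp
  refine hm.of_ball_le (A := C.toNNReal⁻¹) one_pos ?_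
  filter_upwards [hC] with r havg
  rw [withDensity_apply _ measurableSet_ball, one_mul, ENNReal.coe_inv (by simpa using C_pos),
    ← ENNReal.mul_le_iff_le_inv (by simpa using C_pos) ENNReal.coe_ne_top]
  rw [setLAverage_eq] at havg
  exact ENNReal.mul_le_of_le_div havg.1

end Density

section NormedSpace

lemma measure_ball_inter_pos_of_convex {E : Type*} [NormedAddCommGroup E] [NormedSpace ℝ E]
    [MeasurableSpace E] (ν : Measure E) [ν.IsOpenPosMeasure] {K : Set E} (hK : Convex ℝ K)
    (hKi : (interior K).Nonempty) {z : E} (hz : z ∈ K) {r : ℝ} (hr : 0 < r) :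
    0 < ν (ball z r ∩ K) := by
  have z_mem : z ∈ closure (interior K) := by
    rw [hK.closure_interior_eq_closure_of_nonempty_interior hKi]
    exact subset_closure hz
  have nonempty : (ball z r ∩ interior K).Nonempty :=
    mem_closure_iff.1 z_mem _ isOpen_ball (mem_ball_self hr)
  exact ((isOpen_ball.inter isOpen_interior).measure_pos ν nonempty).trans_le
    (measure_mono (inter_subset_inter_right _ interior_subset))

variable {E : Type*} [NormedAddCommGroup E] [NormedSpace ℝ E] [FiniteDimensional ℝ E]
  [MeasurableSpace E] [BorelSpace E] (ν : Measure E) [ν.IsAddHaarMeasure]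

lemma upperRegularAt_addHaar (z : E) : UpperRegularAt ν (Module.finrank ℝ E) z := by
  refine ⟨(ν (ball 0 1)).toNNReal, ?_⟩
  filter_upwards [self_mem_nhdsWithin] with r (r_pos : 0 < r)
  rw [Measure.addHaar_ball_of_pos ν z r_pos, Real.rpow_natCast,
    ENNReal.coe_toNNReal measure_ball_lt_top.ne, mul_comm]

/-- Homotheties centred at `z` with ratio at most `1` map `K` into itself. -/
lemma lowerRegularAt_restrict_of_convex {K : Set E} (hK : Convex ℝ K)
    (hKi : (interior K).Nonempty) {z : E} (hz : z ∈ K) :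
    LowerRegularAt (ν.restrict K) (Module.finrank ℝ E) z := by
  have finite : ν (ball z 1 ∩ K) ≠ ∞ := measure_inter_ne_top_of_left_ne_top measure_ball_lt_top.ne
  refine ⟨(ν (ball z 1 ∩ K)).toNNReal, ENNReal.toNNReal_pos
    (measure_ball_inter_pos_of_convex ν hK hKi hz one_pos).ne' finite, ?_⟩
  filter_upwards [Ioo_mem_nhdsGT one_pos] with r ⟨r_pos, r_lt⟩
  have image_subset : AffineMap.homothety z r '' (ball z 1 ∩ K) ⊆ ball z r ∩ K := by
    rintro _ ⟨y, ⟨hy, hyK⟩, rfl⟩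
    refine ⟨?_, ?_⟩
    · rw [mem_ball, dist_homothety_center, Real.norm_of_nonneg r_pos.le, dist_comm]
      exact mul_lt_of_lt_one_right r_pos hy
    · exact hK.lineMap_mem hz hyK ⟨r_pos.le, r_lt.le⟩
  calc _ = ENNReal.ofReal |r ^ Module.finrank ℝ E| * ν (ball z 1 ∩ K) := by
        rw [ENNReal.coe_toNNReal finite, abs_of_pos (by positivity), Real.rpow_natCast, mul_comm]
    _ = ν (AffineMap.homothety z r '' (ball z 1 ∩ K)) := (Measure.addHaar_image_homothety ..).symm
    _ ≤ ν (ball z r ∩ K) := measure_mono image_subset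
    _ = ν.restrict K (ball z r) := (Measure.restrict_apply measurableSet_ball).symm

end NormedSpace

end Regularity

section RiemannianVolume

open Set Metric

lemma euclideanHausdorffMeasure_image_le {X Y : Type*} [EMetricSpace X] [EMetricSpace Y]
    [MeasurableSpace X] [BorelSpace X] [MeasurableSpace Y] [BorelSpace Y] {K : ℝ≥0} {f : X → Y}
    {s : Set X} (hf : LipschitzOnWith K f s) (D : ℕ) :
    (μHE[D] : Measure Y) (f '' s) ≤ (K ^ D : ℝ≥0) * (μHE[D] : Measure X) s := by
  simp only [Measure.euclideanHausdorffMeasure_def, Measure.smul_apply, ENNReal.smul_def,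
    smul_eq_mul]
  rw [mul_left_comm, ENNReal.coe_pow, ← ENNReal.rpow_natCast]
  gcongr
  exact hf.hausdorffMeasure_image_le D.cast_nonneg

lemma eventually_measure_ball_inter_le {X Y : Type*} [MetricSpace X] [MetricSpace Y]
    [MeasurableSpace X] [BorelSpace X] [MeasurableSpace Y] [BorelSpace Y] (D : ℕ) {f : X → Y}
    {g : Y → X} {A B : ℝ≥0} {p : X} {s S : Set X} {t : Set Y} (hp : p ∈ S) (hB : 0 < B)
    (hf : LipschitzOnWith B f s) (hs : s ∈ 𝓝[S] p) (hg : LipschitzOnWith A g t)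
    (ht : ∀ᶠ x in 𝓝[S] p, f x ∈ t) (hgf : ∀ᶠ x in 𝓝[S] p, g (f x) = x) :
    ∀ᶠ r : ℝ in 𝓝[>] 0,
      (μHE[D] : Measure X) (ball p r ∩ S) ≤
        (A ^ D : ℝ≥0) * (μHE[D] : Measure Y) (ball (f p) (B * r)) := by
  obtain ⟨δ, δ_pos, hδ⟩ := mem_nhdsWithin_iff.1 (inter_mem hs (ht.and hgf))
  filter_upwards [Ioo_mem_nhdsGT δ_pos] with r ⟨_, hr⟩
  have ball_subset : ball p r ∩ S ⊆ g '' (t ∩ ball (f p) (B * r)) := by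
    rintro x ⟨hx, hxS⟩
    obtain ⟨hxs, hxt, hgfx⟩ := hδ ⟨ball_subset_ball hr.le hx, hxS⟩
    refine ⟨f x, ⟨hxt, ?_⟩, hgfx⟩
    exact (hf.dist_le_mul x hxs p (mem_of_mem_nhdsWithin hp hs)).trans_lt
      (mul_lt_mul_of_pos_left hx hB)
  calc (μHE[D] : Measure X) (ball p r ∩ S)
    _ ≤ (μHE[D] : Measure X) (g '' (t ∩ ball (f p) (B * r))) := measure_mono ball_subset
    _ ≤ (A ^ D : ℝ≥0) * (μHE[D] : Measure Y) (t ∩ ball (f p) (B * r)) :=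
      euclideanHausdorffMeasure_image_le (hg.mono inter_subset_left) D
    _ ≤ (A ^ D : ℝ≥0) * (μHE[D] : Measure Y) (ball (f p) (B * r)) := by
      gcongr
      exact inter_subset_right

variable {E : Type*} [NormedAddCommGroup E] [NormedSpace ℝ E] [FiniteDimensional ℝ E]
  {H : Type*} [TopologicalSpace H] (I : ModelWithCorners ℝ E H)
  {X : Type*} [MetricSpace X] [ChartedSpace H X] [IsManifold I 1 X]
  [RiemannianBundle (fun x : X => TangentSpace I x)]
  [IsContinuousRiemannianBundle E (fun x : X => TangentSpace I x)]
  [IsRiemannianManifold I X] [MeasurableSpace X] [BorelSpace X]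

include I in
lemma upperRegularAt_euclideanHausdorffMeasure (p : X) :
    UpperRegularAt (μHE[Module.finrank ℝ E] : Measure X) (Module.finrank ℝ E) p := by
  borelize E
  obtain ⟨B, B_pos, s, hs, hB⟩ := exists_lipschitzOnWith_extChartAt (I := I) p
  obtain ⟨A, -, t, ht, hA⟩ := exists_lipschitzOnWith_extChartAt_symm (I := I) p
  refine (upperRegularAt_addHaar μHE[Module.finrank ℝ E] (extChartAt I p p)).of_ball_le
    (A := A ^ Module.finrank ℝ E) (NNReal.coe_pos.2 B_pos) ?_
  have left_inv : ∀ᶠ x in 𝓝 p, (extChartAt I p).symm (extChartAt I p x) = x :=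
    eventually_of_mem (extChartAt_source_mem_nhds p) fun x hx => (extChartAt I p).left_inv hx
  rw [← map_extChartAt_nhds] at ht
  rw [← nhdsWithin_univ] at hs ht left_inv
  simpa only [inter_univ] using eventually_measure_ball_inter_le (Module.finrank ℝ E) (mem_univ p)
    B_pos hB hs hA ht left_inv

include I in
lemma lowerRegularAt_euclideanHausdorffMeasure (p : X) :
    LowerRegularAt (μHE[Module.finrank ℝ E] : Measure X) (Module.finrank ℝ E) p := by
  borelize E
  obtain ⟨A, -, s, hs, hA⟩ := exists_lipschitzOnWith_extChartAt (I := I) p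
  obtain ⟨B, B_pos, t, ht, hB⟩ := exists_lipschitzOnWith_extChartAt_symm (I := I) p
  have center_mem : extChartAt I p p ∈ range I :=
    extChartAt_target_subset_range p (mem_extChartAt_target p)
  refine (lowerRegularAt_restrict_of_convex μHE[Module.finrank ℝ E] I.convex_range
    I.nonempty_interior center_mem).of_ball_le
    (A := A ^ Module.finrank ℝ E) (NNReal.coe_pos.2 B_pos) ?_
  have tendsto_symm : Tendsto (extChartAt I p).symm (𝓝[range I] (extChartAt I p p)) (𝓝 p) := by
    simpa only [ContinuousAt, extChartAt_to_inv] using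
      (continuousAt_extChartAt_symm (I := I) p).mono_left nhdsWithin_le_nhds
  have right_inv : ∀ᶠ y in 𝓝[range I] (extChartAt I p p),
      extChartAt I p ((extChartAt I p).symm y) = y :=
    eventually_of_mem (extChartAt_target_mem_nhdsWithin p) fun y hy => (extChartAt I p).right_inv hy
  simpa only [Measure.restrict_apply measurableSet_ball, extChartAt_to_inv] using
    eventually_measure_ball_inter_le (Module.finrank ℝ E) center_mem
      B_pos hB ht hA (tendsto_symm hs) right_inv

end RiemannianVolume

section UpperBound

open Set Metric

/-- The function `φ` belongs to the weak `L^s` space of `μ`. The exponent `s` may be smaller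
than `1`, which is the range of non-integrable observables. -/
def MemWeakLp {X : Type*} [MeasurableSpace X] (φ : X → ℝ≥0∞) (s : ℝ) (μ : Measure X) : Prop :=
  ∃ C : ℝ≥0, ∀ t : ℝ, 0 < t → μ {x | ENNReal.ofReal t < φ x} ≤ C * ENNReal.ofReal (t ^ (-s))

section WeakLp

variable {X : Type*} [MeasurableSpace X] {μ : Measure X} {φ : X → ℝ≥0∞} {s : ℝ}

lemma MemWeakLp.ae_ne_top (hφ : MemWeakLp φ s μ) (hs : 0 < s) : ∀ᵐ x ∂μ, φ x ≠ ∞ := by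
  obtain ⟨C, hC⟩ := hφ
  have bound_tendsto : Tendsto (fun t : ℝ => C * ENNReal.ofReal (t ^ (-s))) atTop (𝓝 0) := by
    have ofReal_tendsto := ENNReal.tendsto_ofReal (tendsto_rpow_neg_atTop hs)
    rw [ENNReal.ofReal_zero] at ofReal_tendsto
    simpa only [mul_zero] using
      ENNReal.Tendsto.const_mul ofReal_tendsto (Or.inr (ENNReal.coe_ne_top (r := C)))
  refine le_antisymm (ge_of_tendsto bound_tendsto ?_) zero_le
  filter_upwards [eventually_gt_atTop 0] with t ht
  refine (measure_mono fun x hx => ?_).trans (hC t ht)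
  rw [mem_ofPred_eq, not_not.1 hx]
  exact ENNReal.ofReal_lt_top

lemma lintegral_Ioo_rpow_neg (hs : s < 1) :
    ∫⁻ t in Ioo (0 : ℝ) 1, ENNReal.ofReal (t ^ (-s)) = ENNReal.ofReal (1 - s)⁻¹ := by
  have integrable : IntegrableOn (fun t : ℝ => t ^ (-s)) (Ioo 0 1) :=
    (intervalIntegral.integrableOn_Ioo_rpow_iff one_pos).2 (by linarith)
  rw [← ofReal_integral_eq_lintegral_ofReal integrable, ← integral_Ioc_eq_integral_Ioo,
    ← intervalIntegral.integral_of_le zero_le_one, integral_rpow (.inl (by linarith)),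
    Real.one_rpow, Real.zero_rpow (by linarith), sub_zero, one_div, neg_add_eq_sub]
  filter_upwards [self_mem_ae_restrict measurableSet_Ioo] with t ht
  exact Real.rpow_nonneg ht.1.le _

lemma MemWeakLp.exists_lintegral_min_div_one_le (hφ : MemWeakLp φ s μ) (hφm : AEMeasurable φ μ)
    (hs : s < 1) :
    ∃ C : ℝ≥0, ∀ c : ℝ, 0 < c →
      ∫⁻ x, min (φ x / ENNReal.ofReal c) 1 ∂μ ≤ C * ENNReal.ofReal (c ^ (-s)) := by
  obtain ⟨C, hC⟩ := hφ
  refine ⟨C * (1 - s)⁻¹.toNNReal, fun c hc => ?_⟩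
  set g : X → ℝ≥0∞ := fun x => min (φ x / ENNReal.ofReal c) 1
  have g_ne_top : ∀ x, g x ≠ ∞ := fun x => ne_top_of_le_ne_top ENNReal.one_ne_top (min_le_right _ _)
  have tail_le : ∀ t ∈ Ioi (0 : ℝ), μ {x | t < (g x).toReal} ≤ (Ioo 0 1).indicator
      (fun t => C * ENNReal.ofReal (c ^ (-s)) * ENNReal.ofReal (t ^ (-s))) t := by
    intro t (ht : 0 < t)
    obtain ht1 | ht1 := lt_or_ge t 1
    · rw [indicator_of_mem (show t ∈ Ioo 0 1 from ⟨ht, ht1⟩), mul_assoc,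
        ← ENNReal.ofReal_mul (by positivity), ← Real.mul_rpow hc.le ht.le, mul_comm c]
      refine (measure_mono fun x (hx : t < (g x).toReal) => ?_).trans (hC _ (mul_pos ht hc))
      rw [mem_ofPred_eq, ENNReal.ofReal_mul ht.le, ← ENNReal.lt_div_iff_mul_lt
        (.inl (ENNReal.ofReal_pos.2 hc).ne') (.inl ENNReal.ofReal_ne_top)]
      exact ((ENNReal.ofReal_lt_iff_lt_toReal ht.le (g_ne_top x)).2 hx).trans_le (min_le_left _ _)
    · have empty : {x | t < (g x).toReal} = ∅ := eq_empty_iff_forall_notMem.2 fun x hx =>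
        (hx.trans_le (ENNReal.toReal_le_of_le_ofReal zero_le_one
          (by simpa only [ENNReal.ofReal_one] using min_le_right _ _))).not_ge ht1
      rw [empty, measure_empty]
      exact zero_le
  calc ∫⁻ x, g x ∂μ
    _ = ∫⁻ x, ENNReal.ofReal (g x).toReal ∂μ := by simp only [ENNReal.ofReal_toReal (g_ne_top _)]
    _ = ∫⁻ t in Ioi 0, μ {x | t < (g x).toReal} :=
      lintegral_eq_lintegral_meas_lt μ (ae_of_all _ fun x => ENNReal.toReal_nonneg)
        ((hφm.div_const _).min aemeasurable_const).ennreal_toReal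
    _ ≤ ∫⁻ t in Ioi 0, (Ioo 0 1).indicator
          (fun t => C * ENNReal.ofReal (c ^ (-s)) * ENNReal.ofReal (t ^ (-s))) t :=
      setLIntegral_mono' measurableSet_Ioi tail_le
    _ = C * ENNReal.ofReal (c ^ (-s)) * ENNReal.ofReal (1 - s)⁻¹ := by
      rw [setLIntegral_indicator measurableSet_Ioo, inter_eq_left.2 Ioo_subset_Ioi_self,
        lintegral_const_mul' _ _ (by finiteness), lintegral_Ioo_rpow_neg hs]
    _ = (C * (1 - s)⁻¹.toNNReal : ℝ≥0) * ENNReal.ofReal (c ^ (-s)) := by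
      rw [ENNReal.coe_mul, ENNReal.ofNNReal_toNNReal, mul_right_comm]

end WeakLp

lemma summable_inv_mul_log_rpow {δ : ℝ} (hδ : 0 < δ) :
    Summable fun n : ℕ => ((n : ℝ) * Real.log n ^ (1 + δ))⁻¹ := by
  rw [← summable_condensed_iff_of_eventually_nonneg]
  · have condensed : ∀ i : ℕ, (2 : ℝ) ^ i *
        (((2 ^ i : ℕ) : ℝ) * Real.log (2 ^ i : ℕ) ^ (1 + δ))⁻¹ =
        ((i : ℝ) ^ (1 + δ))⁻¹ * (Real.log 2 ^ (1 + δ))⁻¹ := fun i => by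
      rw [Nat.cast_pow, Nat.cast_ofNat, Real.log_pow,
        Real.mul_rpow i.cast_nonneg (Real.log_nonneg one_le_two)]
      field_simp
    simp_rw [condensed]
    exact (Real.summable_nat_rpow_inv.2 (by linarith)).mul_right _
  · exact Eventually.of_forall fun n => by
      have := Real.log_natCast_nonneg n
      simp only [Pi.zero_apply]
      positivity
  · filter_upwards [eventually_ge_atTop 2] with n hn
    have hn' : (2 : ℝ) ≤ n := by exact_mod_cast hn
    have : 0 < Real.log n := Real.log_pos (by linarith)
    gcongr <;> simp

/-- A truncated form of Kronecker's lemma: dominated convergence for the counting measure. -/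
lemma tendsto_sum_div_of_tsum_min_div_one_ne_top {a c : ℕ → ℝ≥0∞} (ha : ∀ n, a n ≠ ∞)
    (hc : Monotone c) (hct : Tendsto c atTop (𝓝 ∞)) (h : ∑' n, min (a n / c n) 1 ≠ ∞) :
    Tendsto (fun n => (∑ j ∈ Finset.range n, a j) / c n) atTop (𝓝 0) := by
  have term_tendsto : ∀ j, Tendsto (fun n => a j / c n) atTop (𝓝 0) := fun j => by
    simpa only [ENNReal.div_top] using ENNReal.Tendsto.const_div hct (Or.inr (ha j))
  obtain ⟨m, hm⟩ : ∃ m, ∀ j ≥ m, min (a j / c j) 1 < 1 := eventually_atTop.1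
    ((ENNReal.tendsto_atTop_zero_of_tsum_ne_top h).eventually_lt_const one_pos)
  have dominated : ∀ᶠ n in atTop, ∀ j,
      (if j < n then a j / c n else 0) ≤ min (a j / c j) 1 := by
    have head_le_one : ∀ᶠ n in atTop, ∀ j < m, a j / c n ≤ 1 :=
      (eventually_all_finite (finite_lt_nat m)).2 fun j _ =>
        (term_tendsto j).eventually_le_const one_pos
    filter_upwards [head_le_one] with n hn j
    split_ifs with hj
    · have le_div : a j / c n ≤ a j / c j := ENNReal.div_le_div_left (hc hj.le) _
      refine le_min le_div ?_
      obtain hjm | hjm := lt_or_ge j m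
      · exact hn j hjm
      · exact le_div.trans ((min_lt_iff.1 (hm j hjm)).resolve_right (lt_irrefl _)).le
    · exact zero_le
  have sum_eq : ∀ n, (∑ j ∈ Finset.range n, a j) / c n =
      ∫⁻ j, (if j < n then a j / c n else 0) ∂Measure.count := fun n => by
    rw [lintegral_count, tsum_eq_sum (s := Finset.range n)
      (fun j hj => if_neg (by simpa using hj)), div_eq_mul_inv, Finset.sum_mul]
    exact Finset.sum_congr rfl fun j hj => by rw [if_pos (Finset.mem_range.1 hj), div_eq_mul_inv]
  simp_rw [sum_eq]
  have ite_tendsto : ∀ j, Tendsto (fun n => if j < n then a j / c n else 0) atTop (𝓝 0) :=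
    fun j => tendsto_of_tendsto_of_tendsto_of_le_of_le tendsto_const_nhds (term_tendsto j)
      (fun n => zero_le) fun n => by dsimp only; split_ifs; exacts [le_rfl, zero_le]
  simpa only [lintegral_zero] using tendsto_lintegral_filter_of_dominated_convergence
    (f := fun _ => 0) (fun j => min (a j / c j) 1)
    (Eventually.of_forall fun n => measurable_of_countable _)
    (dominated.mono fun n hn => ae_of_all _ hn) (by rwa [lintegral_count])
    (ae_of_all _ ite_tendsto)

lemma monotone_natCast_rpow_mul_log_rpow {a b : ℝ} (ha : 0 < a) (hb : 0 ≤ b) :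
    Monotone fun n : ℕ => (n : ℝ) ^ a * Real.log n ^ b := fun m n hmn => by
  have log_m_nonneg := Real.log_natCast_nonneg m
  obtain rfl | hm := m.eq_zero_or_pos
  · simp only [Nat.cast_zero, Real.zero_rpow ha.ne', zero_mul]
    exact mul_nonneg (by positivity) (Real.rpow_nonneg (Real.log_natCast_nonneg n) b)
  · dsimp only
    gcongr

lemma tendsto_natCast_rpow_mul_log_rpow_atTop {a b : ℝ} (ha : 0 < a) (hb : 0 < b) :
    Tendsto (fun n : ℕ => (n : ℝ) ^ a * Real.log n ^ b) atTop atTop :=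
  ((tendsto_rpow_atTop ha).comp tendsto_natCast_atTop_atTop).atTop_mul_atTop₀
    ((tendsto_rpow_atTop hb).comp (Real.tendsto_log_atTop.comp tendsto_natCast_atTop_atTop))

section MeasurePreserving

variable {X : Type*} [MeasurableSpace X] {μ : Measure X} {T : X → X} {φ : X → ℝ≥0∞}

lemma ae_tendsto_birkhoffS_div_of_tsum_lintegral_ne_top (hT : MeasurePreserving T μ μ)
    (hφm : Measurable φ) (hφ : ∀ᵐ x ∂μ, φ x ≠ ∞) {c : ℕ → ℝ≥0∞} (hc : Monotone c)
    (hct : Tendsto c atTop (𝓝 ∞)) (h : ∑' n, ∫⁻ x, min (φ x / c n) 1 ∂μ ≠ ∞) :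
    ∀ᵐ x ∂μ, Tendsto (fun n => birkhoffS T φ n x / c n) atTop (𝓝 0) := by
  have min_measurable : ∀ n, Measurable fun x => min (φ x / c n) 1 := fun n =>
    (hφm.div_const _).min measurable_const
  have comp_measurable : ∀ n, AEMeasurable (fun x => min (φ (T^[n] x) / c n) 1) μ := fun n =>
    ((min_measurable n).comp (hT.iterate n).measurable).aemeasurable
  have orbit_ne_top : ∀ᵐ x ∂μ, ∀ n, φ (T^[n] x) ≠ ∞ :=
    ae_all_iff.2 fun n => (hT.iterate n).quasiMeasurePreserving.ae hφ
  have lintegral_tsum_ne_top : ∫⁻ x, ∑' n, min (φ (T^[n] x) / c n) 1 ∂μ ≠ ∞ := by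
    rw [lintegral_tsum comp_measurable]
    convert! h using 3 with n
    exact (hT.iterate n).lintegral_comp (min_measurable n)
  filter_upwards [orbit_ne_top,
    ae_lt_top' (AEMeasurable.tsum comp_measurable) lintegral_tsum_ne_top] with x hx hsum
  exact tendsto_sum_div_of_tsum_min_div_one_ne_top hx hc hct hsum.ne

lemma ae_tendsto_birkhoffS_div_of_memWeakLp [IsFiniteMeasure μ] (hT : MeasurePreserving T μ μ)
    (hφm : Measurable φ) {s : ℝ} (hs : 0 < s) (hs1 : s < 1) (hφ : MemWeakLp φ s μ) {ε : ℝ}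
    (hε : 0 < ε) :
    ∀ᵐ x ∂μ, Tendsto (fun n : ℕ => birkhoffS T φ n x /
      ENNReal.ofReal ((n : ℝ) ^ s⁻¹ * Real.log n ^ (s⁻¹ + ε))) atTop (𝓝 0) := by
  set c : ℕ → ℝ := fun n => (n : ℝ) ^ s⁻¹ * Real.log n ^ (s⁻¹ + ε)
  have c_rpow : ∀ n : ℕ, c n ^ (-s) = ((n : ℝ) * Real.log n ^ (1 + ε * s))⁻¹ := fun n => by
    have := Real.log_natCast_nonneg n
    rw [Real.rpow_neg (by positivity), Real.mul_rpow (by positivity) (by positivity),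
      ← Real.rpow_mul (by positivity), ← Real.rpow_mul (by positivity), add_mul,
      inv_mul_cancel₀ hs.ne', Real.rpow_one]
  refine ae_tendsto_birkhoffS_div_of_tsum_lintegral_ne_top hT hφm (hφ.ae_ne_top hs)
    (ENNReal.ofReal_mono.comp (monotone_natCast_rpow_mul_log_rpow (by positivity) (by positivity)))
    (ENNReal.tendsto_ofReal_nhds_top.2 <|
      tendsto_natCast_rpow_mul_log_rpow_atTop (by positivity) (by positivity)) ?_
  obtain ⟨C, hC⟩ := hφ.exists_lintegral_min_div_one_le hφm.aemeasurable hs1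
  have c_pos : ∀ n, 0 < c (n + 2) := fun n => by
    have : 0 < Real.log (n + 2 : ℕ) := Real.log_pos (by norm_cast; lia)
    positivity
  have majorant_summable : Summable fun n => c (n + 2) ^ (-s) := by
    simp_rw [c_rpow]
    exact (summable_nat_add_iff 2).2 (summable_inv_mul_log_rpow (mul_pos hε hs))
  rw [← ENNReal.summable.sum_add_tsum_nat_add' (k := 2)]
  refine ENNReal.add_ne_top.2 ⟨ENNReal.sum_ne_top.2 fun n _ => ?_, ?_⟩
  · refine ne_top_of_le_ne_top (measure_ne_top μ univ) ?_
    exact (lintegral_mono fun x => min_le_right _ _).trans_eq lintegral_one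
  · refine ne_top_of_le_ne_top ?_ (ENNReal.tsum_le_tsum fun n => hC _ (c_pos n))
    rw [ENNReal.tsum_mul_left]
    exact ENNReal.mul_ne_top ENNReal.coe_ne_top majorant_summable.tsum_ofReal_ne_top

end MeasurePreserving

section Pole

variable {X : Type*} [MetricSpace X] [MeasurableSpace X] {μ : Measure X} {p : X}

lemma measurable_poleObservable [OpensMeasurableSpace X] (p : X) (k : ℝ) :
    Measurable (poleObservable p k) :=
  measurable_edist_left.pow_const _

lemma UpperRegularAt.exists_forall_measure_ball_le [IsFiniteMeasure μ] {d : ℝ} (hd : 0 ≤ d)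
    (hμ : UpperRegularAt μ d p) :
    ∃ C : ℝ≥0, ∀ r : ℝ, 0 < r → μ (ball p r) ≤ C * ENNReal.ofReal (r ^ d) := by
  obtain ⟨C, hC⟩ := hμ
  obtain ⟨δ, (δ_pos : 0 < δ), hδ⟩ := mem_nhdsGT_iff_exists_Ioo_subset.1 hC
  refine ⟨C + (μ univ / ENNReal.ofReal (δ ^ d)).toNNReal, fun r hr => ?_⟩
  rw [ENNReal.coe_add, add_mul]
  obtain hrδ | hδr := lt_or_ge r δ
  · exact (hδ ⟨hr, hrδ⟩).trans le_self_add
  have δ_rpow_pos : 0 < ENNReal.ofReal (δ ^ d) := ENNReal.ofReal_pos.2 (by positivity)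
  calc μ (ball p r)
    _ ≤ μ univ / ENNReal.ofReal (δ ^ d) * ENNReal.ofReal (δ ^ d) := by
      rw [ENNReal.div_mul_cancel δ_rpow_pos.ne' ENNReal.ofReal_ne_top]
      exact measure_mono (subset_univ _)
    _ ≤ (μ univ / ENNReal.ofReal (δ ^ d)).toNNReal * ENNReal.ofReal (r ^ d) := by
      rw [ENNReal.coe_toNNReal (ENNReal.div_ne_top (measure_ne_top μ univ) δ_rpow_pos.ne')]
      gcongr
    _ ≤ _ := le_add_self

lemma memWeakLp_poleObservable [IsFiniteMeasure μ] {d k : ℝ} (hd : 0 ≤ d)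
    (hμ : UpperRegularAt μ d p) (hk : 0 < k) : MemWeakLp (poleObservable p k) (d / k) μ := by
  obtain ⟨C, hC⟩ := hμ.exists_forall_measure_ball_le hd
  refine ⟨C, fun t ht => ?_⟩
  have subset_ball : {x | ENNReal.ofReal t < poleObservable p k x} ⊆ ball p (t ^ (-k⁻¹)) := by
    intro x (hx : _ < edist x p ^ (-k))
    rw [mem_ball, ← edist_lt_ofReal, ← ENNReal.ofReal_rpow_of_pos ht, ENNReal.rpow_neg,
      ← ENNReal.inv_rpow, ENNReal.lt_rpow_inv_iff hk]
    rwa [ENNReal.rpow_neg, ← ENNReal.lt_inv_iff_lt_inv] at hx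
  refine (measure_mono subset_ball).trans ((hC _ (by positivity)).trans_eq ?_)
  rw [← Real.rpow_mul ht.le, neg_mul, mul_comm k⁻¹, ← div_eq_mul_inv]

end Pole

end UpperBound

section SecondMoment

open ProbabilityTheory Set

variable {X : Type*} [MeasurableSpace X] {μ : Measure X} {T : X → X} {f g : X → ℝ}

lemma covariance_le_integral_of_mem_Icc [IsProbabilityMeasure μ] (hf : AEStronglyMeasurable f μ)
    (hf01 : ∀ x, f x ∈ Icc 0 1) (hg : AEStronglyMeasurable g μ) (hg01 : ∀ x, g x ∈ Icc 0 1) :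
    cov[f, g; μ] ≤ ∫ x, f x ∂μ := by
  have f_memLp : MemLp f 2 μ := memLp_of_bounded (ae_of_all _ hf01) hf 2
  have g_memLp : MemLp g 2 μ := memLp_of_bounded (ae_of_all _ hg01) hg 2
  rw [covariance_eq_sub f_memLp g_memLp]
  calc ∫ x, f x * g x ∂μ - (∫ x, f x ∂μ) * ∫ x, g x ∂μ
    _ ≤ ∫ x, f x * g x ∂μ := sub_le_self _
      (mul_nonneg (integral_nonneg fun x => (hf01 x).1) (integral_nonneg fun x => (hg01 x).1))
    _ ≤ ∫ x, f x ∂μ := integral_mono (f_memLp.integrable_mul g_memLp)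
      (f_memLp.integrable one_le_two) fun x => mul_le_of_le_one_right (hf01 x).1 (hg01 x).2

lemma card_filter_range_lt_add_le (n K i : ℕ) :
    ((Finset.range n).filter fun j => i < j + K ∧ j < i + K).card ≤ 2 * K := by
  have subset_Ico : ((Finset.range n).filter fun j => i < j + K ∧ j < i + K) ⊆
      Finset.Ico (i + 1 - K) (i + K) := fun j hj => by
    simp only [Finset.mem_filter, Finset.mem_Ico] at hj ⊢
    lia
  have card_le := Finset.card_le_card subset_Ico
  rw [Nat.card_Ico] at card_le
  lia

lemma integral_birkhoffSum (hT : MeasurePreserving T μ μ) (hf : Integrable f μ) (n : ℕ) :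
    ∫ x, birkhoffSum T f n x ∂μ = n * ∫ x, f x ∂μ := by
  simp only [birkhoffSum]
  rw [integral_finsetSum (f := fun j x => f (T^[j] x)) _
    fun j _ => (hT.iterate j).integrable_comp_of_integrable hf]
  have integral_iterate : ∀ j, ∫ x, f (T^[j] x) ∂μ = ∫ x, f x ∂μ := fun j =>
    (hT.iterate j).hasLaw.integral_comp hf.1
  simp only [integral_iterate, Finset.sum_const, Finset.card_range, nsmul_eq_mul]

/-- Of the `n²` covariances which make up the variance, at most `2nK` belong to a pair of times less
than `K` apart. -/
lemma variance_birkhoffSum_le [IsFiniteMeasure μ] (hT : MeasurePreserving T μ μ) (hf : MemLp f 2 μ)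
    {A B : ℝ} (hA : ∀ m, cov[f, f ∘ T^[m]; μ] ≤ A) (hB : 0 ≤ B) {K : ℕ}
    (hK : ∀ m, K ≤ m → cov[f, f ∘ T^[m]; μ] ≤ B) (n : ℕ) :
    Var[birkhoffSum T f n; μ] ≤ n * (2 * K * A) + n ^ 2 * B := by
  have A_nonneg : 0 ≤ A :=
    (variance_nonneg f μ).trans (by simpa [covariance_self hf.aemeasurable] using hA 0)
  have cov_shift : ∀ i m, cov[f ∘ T^[i], f ∘ T^[i + m]; μ] = cov[f, f ∘ T^[m]; μ] := fun i m => by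
    rw [add_comm i m, Function.iterate_add]
    exact (hT.iterate i).hasLaw.covariance_comp hf.aemeasurable
      (hf.comp_measurePreserving (hT.iterate m)).aemeasurable
  have cov_le : ∀ i j, cov[f ∘ T^[i], f ∘ T^[j]; μ] ≤
      (if i < j + K ∧ j < i + K then A else 0) + B := by
    intro i j
    wlog hij : i ≤ j generalizing i j
    · rw [covariance_comm]
      simpa only [and_comm] using this j i (by lia)
    obtain ⟨m, rfl⟩ := Nat.exists_eq_add_of_le hij
    rw [cov_shift]
    split_ifs with hm
    · linarith [hA m]
    · linarith [hK m (by lia)]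
  calc Var[birkhoffSum T f n; μ]
    _ = ∑ i ∈ Finset.range n, ∑ j ∈ Finset.range n, cov[f ∘ T^[i], f ∘ T^[j]; μ] :=
      variance_fun_sum' fun i _ => hf.comp_measurePreserving (hT.iterate i)
    _ ≤ ∑ i ∈ Finset.range n, ∑ j ∈ Finset.range n,
        ((if i < j + K ∧ j < i + K then A else 0) + B) :=
      Finset.sum_le_sum fun i _ => Finset.sum_le_sum fun j _ => cov_le i j
    _ ≤ ∑ i ∈ Finset.range n, (2 * K * A + n * B) := by
      gcongr with i
      rw [Finset.sum_add_distrib, ← Finset.sum_filter, Finset.sum_const, Finset.sum_const,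
        Finset.card_range, nsmul_eq_mul, nsmul_eq_mul]
      gcongr
      exact_mod_cast card_filter_range_lt_add_le n K i
    _ = n * (2 * K * A) + n ^ 2 * B := by
      rw [Finset.sum_const, Finset.card_range, nsmul_eq_mul]
      ring

lemma measureReal_birkhoffSum_le_half_integral [IsProbabilityMeasure μ]
    (hT : MeasurePreserving T μ μ) (hf : AEStronglyMeasurable f μ) (hf01 : ∀ x, f x ∈ Icc 0 1)
    (hpos : 0 < ∫ x, f x ∂μ) {B : ℝ} (hB : 0 ≤ B) {K : ℕ}
    (hK : ∀ m, K ≤ m → cov[f, f ∘ T^[m]; μ] ≤ B) {n : ℕ} (hn : 0 < n) :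
    μ.real {x | birkhoffSum T f n x ≤ n * (∫ x, f x ∂μ) / 2} ≤
      8 * K / (n * ∫ x, f x ∂μ) + 4 * B / (∫ x, f x ∂μ) ^ 2 := by
  set e := ∫ x, f x ∂μ
  have f_memLp : MemLp f 2 μ := memLp_of_bounded (ae_of_all _ hf01) hf 2
  have sum_memLp : MemLp (birkhoffSum T f n) 2 μ :=
    memLp_finsetSum _ fun j _ => f_memLp.comp_measurePreserving (hT.iterate j)
  have variance_le := variance_birkhoffSum_le hT f_memLp (fun m => covariance_le_integral_of_mem_Icc
    hf hf01 (f_memLp.comp_measurePreserving (hT.iterate m)).1 fun x => hf01 _) hB hK n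
  have half_mean_pos : 0 < n * e / 2 := by positivity
  have chebyshev := meas_ge_le_variance_div_sq sum_memLp half_mean_pos
  rw [integral_birkhoffSum hT (f_memLp.integrable one_le_two)] at chebyshev
  refine (ENNReal.toReal_le_of_le_ofReal (by positivity [variance_nonneg (birkhoffSum T f n) μ])
    ((measure_mono fun x hx => ?_).trans chebyshev)).trans ?_
  · rw [mem_ofPred_eq] at hx ⊢
    rw [abs_sub_comm]
    exact (by linarith : n * e / 2 ≤ n * e - birkhoffSum T f n x).trans (le_abs_self _)
  · calc Var[birkhoffSum T f n; μ] / (n * e / 2) ^ 2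
      _ ≤ (n * (2 * K * e) + n ^ 2 * B) / (n * e / 2) ^ 2 := by gcongr
      _ = 8 * K / (n * e) + 4 * B / e ^ 2 := by
        field_simp
        ring

end SecondMoment

section VisitsToBalls

open ProbabilityTheory Set Metric

lemma ae_eventually_notMem_of_summable_measureReal {X : Type*} [MeasurableSpace X] {μ : Measure X}
    [IsFiniteMeasure μ] {S : ℕ → Set X} {b : ℕ → ℝ} (hb : Summable b)
    (hS : ∀ᶠ i in atTop, μ.real (S i) ≤ b i) : ∀ᵐ x ∂μ, ∀ᶠ i in atTop, x ∉ S i := by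
  have measureReal_summable : Summable fun i => μ.real (S i) := by
    refine Summable.of_norm_bounded_eventually_nat hb ?_
    simpa only [Real.norm_of_nonneg measureReal_nonneg] using hS
  refine ae_eventually_notMem ?_
  convert! measureReal_summable.tsum_ofReal_ne_top with i
  exact (ofReal_measureReal).symm

variable {X : Type*} [MetricSpace X]

lemma lipNorm_nonneg (f : X → ℝ) : 0 ≤ lipNorm f :=
  add_nonneg (Real.iSup_nonneg fun _ => abs_nonneg _) (Real.sInf_nonneg fun _ hK => hK.1)

lemma lipNorm_le_add [Nonempty X] {f : X → ℝ} {M : ℝ} {K : ℝ≥0} (hM : ∀ x, |f x| ≤ M)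
    (hK : LipschitzWith K f) : lipNorm f ≤ M + K :=
  add_le_add (ciSup_le hM) (csInf_le ⟨0, fun _ hL => hL.1⟩ ⟨K.2, hK.dist_le_mul⟩)

lemma exists_isBddLipschitz_indicator_ball_le (p : X) {r : ℝ} (hr : 0 < r) :
    ∃ f : X → ℝ, IsBddLipschitz f ∧ lipNorm f ≤ 1 + 2 / r ∧ (∀ x, f x ∈ Icc 0 1) ∧
      (ball p (r / 2)).indicator 1 ≤ f ∧ f ≤ (ball p r).indicator 1 := by
  have : Nonempty X := ⟨p⟩
  set f : X → ℝ := fun x => thickenedIndicator (half_pos hr) (ball p (r / 2)) x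
  have f_le_one : ∀ x, f x ≤ 1 := thickenedIndicator_le_one (half_pos hr) _
  have f_abs_le : ∀ x, |f x| ≤ 1 := fun x =>
    (abs_of_nonneg (NNReal.coe_nonneg _)).trans_le (f_le_one x)
  have f_lipschitz : LipschitzWith (r / 2).toNNReal⁻¹ f :=
    lipschitzWith_thickenedIndicator (half_pos hr) _
  refine ⟨f, ⟨⟨_, f_lipschitz⟩, 1, f_abs_le⟩, ?_, fun x => ⟨NNReal.coe_nonneg _, f_le_one x⟩,
    fun x => ?_, fun x => le_indicator_apply (fun _ => f_le_one x) fun hx => ?_⟩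
  · refine (lipNorm_le_add f_abs_le f_lipschitz).trans_eq ?_
    rw [NNReal.coe_inv, Real.coe_toNNReal _ (half_pos hr).le, inv_div]
  · refine indicator_apply_le' (fun hx => ?_) fun _ => NNReal.coe_nonneg _
    simp only [f, thickenedIndicator_one _ _ hx, NNReal.coe_one, Pi.one_apply, le_refl]
  · have notMem_thickening : x ∉ thickening (r / 2) (ball p (r / 2)) := fun h =>
      hx (by simpa only [add_halves] using thickening_ball p (r / 2) (r / 2) h)
    simp only [f, thickenedIndicator_zero _ _ notMem_thickening, NNReal.coe_zero, le_refl]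

variable [MeasurableSpace X] [BorelSpace X] {T : X → X} {μ : Measure X} [IsProbabilityMeasure μ]

lemma ExpDecayLipschitz.exists_covariance_le (hA : ExpDecayLipschitz T μ)
    (hT : MeasurePreserving T μ μ) :
    ∃ C θ : ℝ, 0 ≤ C ∧ 0 < θ ∧ θ < 1 ∧ ∀ f : X → ℝ, IsBddLipschitz f → ∀ m : ℕ,
      cov[f, f ∘ T^[m]; μ] ≤ C * θ ^ m * lipNorm f ^ 2 := by
  obtain ⟨C, θ, hθ, hθ1, hC⟩ := hA
  refine ⟨|C|, θ, abs_nonneg C, hθ, hθ1, fun f hf m => ?_⟩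
  obtain ⟨⟨K, hK⟩, M, hM⟩ := id hf
  have f_memLp : MemLp f 2 μ :=
    MemLp.of_bound hK.continuous.measurable.aestronglyMeasurable M (ae_of_all _ hM)
  rw [covariance_eq_sub f_memLp (f_memLp.comp_measurePreserving (hT.iterate m)),
    (hT.iterate m).hasLaw.integral_comp f_memLp.1]
  calc _ ≤ C * θ ^ m * lipNorm f * lipNorm f := (le_abs_self _).trans (hC f f hf hf m)
    _ = C * θ ^ m * lipNorm f ^ 2 := by ring
    _ ≤ |C| * θ ^ m * lipNorm f ^ 2 := by
      gcongr
      exact le_abs_self C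

lemma ExpDecayLipschitz.exists_measureReal_birkhoffSum_indicator_ball_le
    (hA : ExpDecayLipschitz T μ) (hT : MeasurePreserving T μ μ) :
    ∃ C θ : ℝ, 0 ≤ C ∧ 0 < θ ∧ θ < 1 ∧ ∀ (p : X) (r v : ℝ), 0 < r → 0 < v →
      v ≤ μ.real (ball p (r / 2)) → ∀ K n : ℕ, 0 < n →
        μ.real {x | birkhoffSum T ((ball p r).indicator (1 : X → ℝ)) n x ≤ n * v / 2} ≤
          8 * K / (n * v) + C * θ ^ K * (1 + 2 / r) ^ 2 / v ^ 2 := by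
  obtain ⟨C, θ, hC, hθ, hθ1, hcov⟩ := hA.exists_covariance_le hT
  refine ⟨4 * C, θ, by positivity, hθ, hθ1, fun p r v hr hv hvμ K n hn => ?_⟩
  obtain ⟨f, hf, lipNorm_f_le, f_mem_Icc, indicator_le, le_indicator⟩ :=
    exists_isBddLipschitz_indicator_ball_le p hr
  have f_aesm : AEStronglyMeasurable f μ :=
    hf.1.choose_spec.continuous.measurable.aestronglyMeasurable
  have v_le_integral : v ≤ ∫ x, f x ∂μ := by
    refine hvμ.trans ?_
    rw [← integral_indicator_one measurableSet_ball]
    exact integral_mono ((integrable_const (1 : ℝ)).indicator measurableSet_ball)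
      ((memLp_of_bounded (ae_of_all _ f_mem_Icc) f_aesm 1).integrable le_rfl) indicator_le
  have cov_le : ∀ m, K ≤ m → cov[f, f ∘ T^[m]; μ] ≤ C * θ ^ K * (1 + 2 / r) ^ 2 := fun m hm =>
    (hcov f hf m).trans <| by
      have := pow_le_pow_of_le_one hθ.le hθ1.le hm
      have := lipNorm_nonneg f
      gcongr
  calc μ.real {x | birkhoffSum T ((ball p r).indicator (1 : X → ℝ)) n x ≤ n * v / 2}
    _ ≤ μ.real {x | birkhoffSum T f n x ≤ n * (∫ x, f x ∂μ) / 2} := by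
      refine measureReal_mono (ofPred_subset_ofPred.2 fun x hx => ?_)
      have birkhoffSum_le : birkhoffSum T f n x ≤ birkhoffSum T ((ball p r).indicator 1) n x :=
        Finset.sum_le_sum fun j _ => le_indicator _
      refine (birkhoffSum_le.trans hx).trans ?_
      gcongr
    _ ≤ 8 * K / (n * ∫ x, f x ∂μ) + 4 * (C * θ ^ K * (1 + 2 / r) ^ 2) / (∫ x, f x ∂μ) ^ 2 :=
      measureReal_birkhoffSum_le_half_integral hT f_aesm f_mem_Icc (hv.trans_le v_le_integral)
        (by positivity) cov_le hn
    _ ≤ 8 * K / (n * v) + 4 * (C * θ ^ K * (1 + 2 / r) ^ 2) / v ^ 2 := by gcongr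
    _ = 8 * K / (n * v) + 4 * C * θ ^ K * (1 + 2 / r) ^ 2 / v ^ 2 := by ring

end VisitsToBalls

section LowerBound

open Set Metric

variable {X : Type*} [MetricSpace X]

lemma ofReal_rpow_neg_le_poleObservable {p x : X} {r k : ℝ} (hr : 0 < r) (hk : 0 ≤ k)
    (hx : dist x p ≤ r) : ENNReal.ofReal (r ^ (-k)) ≤ poleObservable p k x := by
  rw [poleObservable, ← ENNReal.ofReal_rpow_of_pos hr, ENNReal.rpow_neg, ENNReal.rpow_neg,
    ENNReal.inv_le_inv, edist_dist]
  gcongr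

lemma ofReal_rpow_neg_mul_birkhoffSum_indicator_ball_le {T : X → X} {p : X} {r k : ℝ} (hr : 0 < r)
    (hk : 0 ≤ k) (n : ℕ) (x : X) :
    ENNReal.ofReal (r ^ (-k) * birkhoffSum T ((ball p r).indicator 1) n x) ≤
      birkhoffS T (poleObservable p k) n x := by
  have summand_nonneg : ∀ j, 0 ≤ r ^ (-k) * (ball p r).indicator 1 (T^[j] x) := fun j =>
    mul_nonneg (by positivity) (indicator_nonneg (fun _ _ => zero_le_one) _)
  rw [birkhoffSum, Finset.mul_sum, ENNReal.ofReal_sum_of_nonneg fun j _ => summand_nonneg j]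
  refine Finset.sum_le_sum fun j _ => ?_
  by_cases hj : T^[j] x ∈ ball p r
  · rw [indicator_of_mem hj, Pi.one_apply, mul_one]
    exact ofReal_rpow_neg_le_poleObservable hr hk (mem_ball.1 hj).le
  · rw [indicator_of_notMem hj, mul_zero, ENNReal.ofReal_zero]
    exact zero_le

lemma tendsto_nat_log_atTop {b : ℕ} (hb : 1 < b) : Tendsto (Nat.log b) atTop atTop :=
  tendsto_atTop.2 fun m => (eventually_ge_atTop (b ^ m)).mono fun _ => Nat.le_log_of_pow_le hb

lemma birkhoffS_mono {X : Type*} (T : X → X) (φ : X → ℝ≥0∞) (x : X) :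
    Monotone fun n => birkhoffS T φ n x := fun _ _ hmn =>
  Finset.sum_le_sum_of_subset (Finset.range_mono hmn)

lemma tendsto_cube_div_two_pow_rpow_inv {d : ℝ} (hd : 0 < d) :
    Tendsto (fun i : ℕ => ((i : ℝ) ^ 3 / 2 ^ i) ^ d⁻¹) atTop (𝓝[>] 0) := by
  refine tendsto_nhdsWithin_iff.2 ⟨?_, (eventually_gt_atTop 0).mono fun i hi =>
    Real.rpow_pos_of_pos (by positivity) _⟩
  simpa only [Real.zero_rpow (inv_pos.2 hd).ne'] using
    (tendsto_pow_const_div_const_pow_of_one_lt 3 one_lt_two).rpow_const (.inr (inv_pos.2 hd).le)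

lemma inv_rpow_inv_sq_mul_sq_le_pow {d u : ℝ} (hd : 0 < d) (hu : 0 < u) {i : ℕ}
    (hui : u⁻¹ ≤ 2 ^ i) : ((u ^ d⁻¹) ^ 2 * u ^ 2)⁻¹ ≤ (((2 : ℝ) ^ d⁻¹) ^ 2 * 2 ^ 2) ^ i := by
  calc ((u ^ d⁻¹) ^ 2 * u ^ 2)⁻¹
    _ = ((u⁻¹) ^ d⁻¹) ^ 2 * (u⁻¹) ^ 2 := by
      rw [mul_inv, ← inv_pow, ← inv_pow, Real.inv_rpow hu.le]
    _ ≤ (((2 : ℝ) ^ i) ^ d⁻¹) ^ 2 * (2 ^ i) ^ 2 := by gcongr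
    _ = (((2 : ℝ) ^ d⁻¹) ^ 2 * 2 ^ 2) ^ i := by
      rw [← Real.rpow_pow_comm zero_le_two, mul_pow, pow_right_comm _ i, pow_right_comm _ i]

lemma eventually_two_mul_mul_exp_neg_log_rpow_le {a : ℝ} (ha : 0 < a) :
    ∀ᶠ n : ℕ in atTop,
      2 * (n * Real.exp (-(Real.log n ^ a))) ≤ 2 ^ Nat.log 2 n / (Nat.log 2 n : ℝ) ^ 3 := by
  have log_tendsto : Tendsto (fun n : ℕ => Real.log n) atTop atTop :=
    Real.tendsto_log_atTop.comp tendsto_natCast_atTop_atTop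
  have exp_dominates := (tendsto_exp_div_rpow_atTop (3 / a)).comp
    ((tendsto_rpow_atTop ha).comp log_tendsto)
  filter_upwards [exp_dominates.eventually_ge_atTop 32, log_tendsto.eventually_gt_atTop 0,
    (tendsto_nat_log_atTop one_lt_two).eventually_ge_atTop 1, eventually_ne_atTop 0]
    with n hexp hlog hi hn
  simp only [Function.comp_apply] at hexp
  rw [← Real.rpow_mul hlog.le, mul_div_cancel₀ _ ha.ne', le_div_iff₀ (by positivity),
    Real.rpow_ofNat] at hexp
  have n_le : (n : ℝ) ≤ 2 * 2 ^ Nat.log 2 n := by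
    rw [← pow_succ']
    exact_mod_cast (Nat.lt_pow_succ_log_self one_lt_two n).le
  have natLog_le : (Nat.log 2 n : ℝ) ≤ 2 * Real.log n := by
    have log_pow_le : Nat.log 2 n * Real.log 2 ≤ Real.log n := by
      rw [← Real.log_pow]
      exact Real.log_le_log (by positivity) (by exact_mod_cast Nat.pow_log_le_self 2 hn)
    nlinarith [Real.log_two_gt_d9]
  rw [Real.exp_neg, ← div_eq_mul_inv, ← mul_div_assoc,
    div_le_div_iff₀ (by positivity) (by positivity)]
  calc 2 * (n : ℝ) * (Nat.log 2 n : ℝ) ^ 3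
    _ ≤ 2 * (2 * 2 ^ Nat.log 2 n) * (2 * Real.log n) ^ 3 := by gcongr
    _ = 2 ^ Nat.log 2 n * (32 * Real.log n ^ 3) := by ring
    _ ≤ 2 ^ Nat.log 2 n * Real.exp (Real.log n ^ a) := by gcongr

variable [MeasurableSpace X] {T : X → X} {μ : Measure X} {p : X} {d : ℝ}

lemma LowerRegularAt.exists_eventually_le_measureReal_ball_half [IsFiniteMeasure μ]
    (hμ : LowerRegularAt μ d p) :
    ∃ c : ℝ, 0 < c ∧ ∀ᶠ r : ℝ in 𝓝[>] 0, c * r ^ d ≤ μ.real (ball p (r / 2)) := by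
  obtain ⟨c, c_pos, hc⟩ := hμ
  refine ⟨c * 2⁻¹ ^ d, by positivity, ?_⟩
  filter_upwards [eventually_nhdsGT_zero_mul_left (inv_pos.2 two_pos) hc, self_mem_nhdsWithin]
    with r hr (r_pos : 0 < r)
  rw [mul_assoc, ← Real.mul_rpow (by positivity) r_pos.le, div_eq_inv_mul]
  refine (ENNReal.ofReal_le_iff_le_toReal (measure_ne_top _ _)).1 ?_
  rwa [ENNReal.ofReal_mul c.coe_nonneg, ENNReal.ofReal_coe_nnreal]

lemma exists_pos_measureReal_ball_half_pos (μ : Measure X) [IsProbabilityMeasure μ] (p : X) :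
    ∃ r : ℝ, 0 < r ∧ 0 < μ.real (ball p (r / 2)) := by
  obtain ⟨n, hn⟩ : ∃ n : ℕ, 0 < μ (ball p n) :=
    exists_measure_pos_of_not_measure_iUnion_null (by
      rw [iUnion_ball_nat, measure_univ]
      exact one_ne_zero)
  have n_pos : (0 : ℝ) < n := nonempty_ball.1 (nonempty_of_measure_ne_zero hn.ne')
  refine ⟨2 * n, by positivity, ?_⟩
  rw [mul_div_cancel_left₀ _ two_ne_zero]
  exact ENNReal.toReal_pos hn.ne' (measure_ne_top _ _)

variable [BorelSpace X] [IsProbabilityMeasure μ]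

lemma ExpDecayLipschitz.exists_measureReal_forall_iterate_notMem_ball_le
    (hA : ExpDecayLipschitz T μ) (hT : MeasurePreserving T μ μ) (hμ : LowerRegularAt μ d p) :
    ∃ C θ : ℝ, 0 ≤ C ∧ 0 < θ ∧ θ < 1 ∧ ∀ᶠ r : ℝ in 𝓝[>] 0, ∀ K n : ℕ, 0 < n →
      μ.real {x | ∀ j < n, T^[j] x ∉ ball p r} ≤
        C * (K / (n * r ^ d) + θ ^ K / (r ^ 2 * (r ^ d) ^ 2)) := by
  obtain ⟨C, θ, hC, hθ, hθ1, hvisit⟩ :=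
    hA.exists_measureReal_birkhoffSum_indicator_ball_le hT
  obtain ⟨c, c_pos, hc⟩ := hμ.exists_eventually_le_measureReal_ball_half
  refine ⟨8 / c + 9 * C / c ^ 2, θ, by positivity, hθ, hθ1, ?_⟩
  filter_upwards [hc, Ioo_mem_nhdsGT one_pos] with r hr ⟨r_pos, hr1⟩ K n hn
  have norm_le : 1 + 2 / r ≤ 3 / r := by
    rw [le_div_iff₀ r_pos, add_mul, div_mul_cancel₀ _ r_pos.ne']
    linarith
  calc μ.real {x | ∀ j < n, T^[j] x ∉ ball p r}
    _ ≤ μ.real {x | birkhoffSum T ((ball p r).indicator (1 : X → ℝ)) n x ≤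
          n * (c * r ^ d) / 2} := by
      refine measureReal_mono (ofPred_subset_ofPred.2 fun x hx => ?_)
      rw [birkhoffSum, Finset.sum_eq_zero fun j hj =>
        indicator_of_notMem (hx j (Finset.mem_range.1 hj)) _]
      positivity
    _ ≤ 8 * K / (n * (c * r ^ d)) + C * θ ^ K * (1 + 2 / r) ^ 2 / (c * r ^ d) ^ 2 :=
      hvisit p r _ r_pos (by positivity) hr K n hn
    _ ≤ 8 * K / (n * (c * r ^ d)) + C * θ ^ K * (3 / r) ^ 2 / (c * r ^ d) ^ 2 := by gcongr
    _ = 8 / c * (K / (n * r ^ d)) + 9 * C / c ^ 2 * (θ ^ K / (r ^ 2 * (r ^ d) ^ 2)) := by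
      field_simp
      ring
    _ ≤ (8 / c + 9 * C / c ^ 2) * (K / (n * r ^ d)) +
        (8 / c + 9 * C / c ^ 2) * (θ ^ K / (r ^ 2 * (r ^ d) ^ 2)) := by
      gcongr
      · exact le_add_of_nonneg_right (by positivity)
      · exact le_add_of_nonneg_left (by positivity)
    _ = _ := (mul_add _ _ _).symm

/-- The radius makes the expected number of visits before time `2 ^ i` of order `i ^ 3`. As only
times less than `M * i` apart correlate, the probability of no visit is of order `i ^ (-2)`. -/
lemma ExpDecayLipschitz.ae_eventually_exists_iterate_mem_ball (hA : ExpDecayLipschitz T μ)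
    (hT : MeasurePreserving T μ μ) (hd : 0 < d) (hμ : LowerRegularAt μ d p) :
    ∀ᵐ x ∂μ, ∀ᶠ i : ℕ in atTop,
      ∃ j < 2 ^ i, T^[j] x ∈ ball p (((i : ℝ) ^ 3 / 2 ^ i) ^ d⁻¹) := by
  obtain ⟨C, θ, hC, hθ, hθ1, hmiss⟩ := hA.exists_measureReal_forall_iterate_notMem_ball_le hT hμ
  set B : ℝ := ((2 : ℝ) ^ d⁻¹) ^ 2 * 2 ^ 2
  have B_pos : 0 < B := by positivity
  obtain ⟨M, hM⟩ := exists_pow_lt_of_lt_one (show 0 < (2 * B)⁻¹ by positivity) hθ1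
  have bound_summable : Summable fun i : ℕ => C * (M * ((i : ℝ) ^ 2)⁻¹ + (1 / 2) ^ i) :=
    (((Real.summable_nat_pow_inv.2 one_lt_two).mul_left _).add
      summable_geometric_two).mul_left _
  refine (ae_eventually_notMem_of_summable_measureReal (S := fun i => {x | ∀ j < 2 ^ i,
    T^[j] x ∉ ball p (((i : ℝ) ^ 3 / 2 ^ i) ^ d⁻¹)}) bound_summable ?_).mono fun x hx =>
      hx.mono fun i hi => by simpa only [mem_ofPred_eq, not_forall, not_not, exists_prop] using hi
  filter_upwards [(tendsto_cube_div_two_pow_rpow_inv hd).eventually hmiss, eventually_gt_atTop 0]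
    with i hi i_pos
  refine (hi (M * i) (2 ^ i) (by positivity)).trans ?_
  set u : ℝ := (i : ℝ) ^ 3 / 2 ^ i with hu
  have u_pos : 0 < u := by positivity
  have inv_u_le : u⁻¹ ≤ 2 ^ i := by
    rw [hu, inv_div]
    exact div_le_self (by positivity) (one_le_pow₀ (by exact_mod_cast i_pos))
  have radius_rpow : (u ^ d⁻¹) ^ d = u := Real.rpow_inv_rpow u_pos.le hd.ne'
  have inv_radius_le : ((u ^ d⁻¹) ^ 2 * u ^ 2)⁻¹ ≤ B ^ i :=
    inv_rpow_inv_sq_mul_sq_le_pow hd u_pos inv_u_le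
  rw [radius_rpow]
  gcongr C * (?_ + ?_)
  · rw [hu]
    push_cast
    field_simp
    rfl
  · calc θ ^ (M * i) / ((u ^ d⁻¹) ^ 2 * u ^ 2)
      _ ≤ ((2 * B)⁻¹) ^ i * B ^ i := by
        rw [div_eq_mul_inv, pow_mul]
        gcongr
      _ = (1 / 2) ^ i := by
        rw [← mul_pow]
        congr 1
        field_simp

lemma ExpDecayLipschitz.ae_one_lt_liminf_birkhoffS_div (hA : ExpDecayLipschitz T μ)
    (hT : MeasurePreserving T μ μ) (hd : 0 < d) (hμ : LowerRegularAt μ d p) {k a : ℝ}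
    (hk : 0 < k) (ha : 0 < a) :
    ∀ᵐ x ∂μ, 1 < liminf (fun n : ℕ => birkhoffS T (poleObservable p k) n x /
      ENNReal.ofReal ((n : ℝ) ^ (k / d) * Real.exp (-(Real.log n ^ a)) ^ (k / d))) atTop := by
  filter_upwards [hA.ae_eventually_exists_iterate_mem_ball hT hd hμ] with x hx
  have one_lt : 1 < ENNReal.ofReal (2 ^ (k / d)) :=
    ENNReal.one_lt_ofReal.2 (Real.one_lt_rpow one_lt_two (by positivity))
  refine one_lt.trans_le (le_liminf_of_le (by isBoundedDefault) ?_)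
  filter_upwards [(tendsto_nat_log_atTop one_lt_two).eventually hx,
    (tendsto_nat_log_atTop one_lt_two).eventually_gt_atTop 0, eventually_ne_atTop 0,
    eventually_two_mul_mul_exp_neg_log_rpow_le ha] with n ⟨j, hj, hjp⟩ hi hn hle
  set i := Nat.log 2 n
  have n_pos : (0 : ℝ) < n := by exact_mod_cast n.pos_of_ne_zero hn
  rw [ENNReal.le_div_iff_mul_le (.inl (ENNReal.ofReal_pos.2 (by positivity)).ne')
    (.inl ENNReal.ofReal_ne_top), ← ENNReal.ofReal_mul (by positivity)]
  calc ENNReal.ofReal (2 ^ (k / d) * (n ^ (k / d) * Real.exp (-(Real.log n ^ a)) ^ (k / d)))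
    _ = ENNReal.ofReal ((2 * (n * Real.exp (-(Real.log n ^ a)))) ^ (k / d)) := by
      rw [Real.mul_rpow zero_le_two (by positivity), Real.mul_rpow n_pos.le (by positivity)]
    _ ≤ ENNReal.ofReal ((2 ^ i / (i : ℝ) ^ 3) ^ (k / d)) := by gcongr
    _ = ENNReal.ofReal ((((i : ℝ) ^ 3 / 2 ^ i) ^ d⁻¹) ^ (-k)) := by
      rw [← Real.rpow_mul (by positivity), mul_neg, Real.rpow_neg (by positivity),
        ← Real.inv_rpow (by positivity), inv_div, ← div_eq_inv_mul]
    _ ≤ poleObservable p k (T^[j] x) :=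
      ofReal_rpow_neg_le_poleObservable (by positivity) hk.le (mem_ball.1 hjp).le
    _ ≤ birkhoffS T (poleObservable p k) n x :=
      Finset.single_le_sum (f := fun j => poleObservable p k (T^[j] x)) (fun _ _ => zero_le)
        (Finset.mem_range.2 (hj.trans_le (Nat.pow_log_le_self 2 hn)))

lemma ExpDecayLipschitz.ae_eventually_lt_birkhoffSum_indicator_ball (hA : ExpDecayLipschitz T μ)
    (hT : MeasurePreserving T μ μ) {r v : ℝ} (hr : 0 < r) (hv : 0 < v)
    (hvμ : v ≤ μ.real (ball p (r / 2))) :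
    ∀ᵐ x ∂μ, ∀ᶠ i : ℕ in atTop,
      2 ^ i * v / 2 < birkhoffSum T ((ball p r).indicator 1) (2 ^ i) x := by
  obtain ⟨C, θ, -, hθ, hθ1, hvisit⟩ := hA.exists_measureReal_birkhoffSum_indicator_ball_le hT
  have mul_geometric_summable : Summable fun i : ℕ => (i : ℝ) ^ 1 * (1 / 2) ^ i :=
    summable_pow_mul_geometric_of_norm_lt_one 1 (by norm_num)
  have bound_summable : Summable fun i : ℕ =>
      8 / v * ((i : ℝ) ^ 1 * (1 / 2) ^ i) + C * (1 + 2 / r) ^ 2 / v ^ 2 * θ ^ i :=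
    (mul_geometric_summable.mul_left _).add
      ((summable_geometric_of_lt_one hθ.le hθ1).mul_left _)
  have few_visits_le : ∀ i : ℕ,
      μ.real {x | birkhoffSum T ((ball p r).indicator (1 : X → ℝ)) (2 ^ i) x ≤ 2 ^ i * v / 2} ≤
        8 / v * ((i : ℝ) ^ 1 * (1 / 2) ^ i) + C * (1 + 2 / r) ^ 2 / v ^ 2 * θ ^ i := fun i => by
    have bound := hvisit p r v hr hv hvμ i (2 ^ i) (by positivity)
    rw [Nat.cast_pow, Nat.cast_ofNat] at bound
    refine bound.trans_eq ?_
    rw [one_div_pow]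
    field_simp
  filter_upwards [ae_eventually_notMem_of_summable_measureReal bound_summable
    (.of_forall few_visits_le)] with x hx
  filter_upwards [hx] with i hi
  simpa only [mem_ofPred_eq, not_le] using hi

lemma ExpDecayLipschitz.exists_ae_lt_liminf_birkhoffS_div (hA : ExpDecayLipschitz T μ)
    (hT : MeasurePreserving T μ μ) (p : X) {k : ℝ} (hk : 0 ≤ k) :
    ∃ a : ℝ, 0 < a ∧ ∀ᵐ x ∂μ, ENNReal.ofReal a <
      liminf (fun n : ℕ => birkhoffS T (poleObservable p k) n x / (n : ℝ≥0∞)) atTop := by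
  obtain ⟨r, hr, hv⟩ := exists_pos_measureReal_ball_half_pos μ p
  set v := μ.real (ball p (r / 2))
  have b_pos : 0 < r ^ (-k) * v / 4 := by positivity
  refine ⟨r ^ (-k) * v / 4 / 2, half_pos b_pos, ?_⟩
  filter_upwards [hA.ae_eventually_lt_birkhoffSum_indicator_ball hT hr hv le_rfl] with x hx
  refine ((ENNReal.ofReal_lt_ofReal_iff b_pos).2 (half_lt_self b_pos)).trans_le
    (le_liminf_of_le (by isBoundedDefault) ?_)
  filter_upwards [(tendsto_nat_log_atTop one_lt_two).eventually hx, eventually_ne_atTop 0]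
    with n hn hn0
  set i := Nat.log 2 n
  have n_le : (n : ℝ) ≤ 2 * 2 ^ i := by
    rw [← pow_succ']
    exact_mod_cast (Nat.lt_pow_succ_log_self one_lt_two n).le
  rw [ENNReal.le_div_iff_mul_le (.inl (Nat.cast_ne_zero.2 hn0)) (.inl (ENNReal.natCast_ne_top n)),
    ← ENNReal.ofReal_natCast, ← ENNReal.ofReal_mul b_pos.le]
  calc ENNReal.ofReal (r ^ (-k) * v / 4 * n)
    _ ≤ ENNReal.ofReal (r ^ (-k) * v / 4 * (2 * 2 ^ i)) := by gcongr
    _ = ENNReal.ofReal (r ^ (-k) * (2 ^ i * v / 2)) := by ring_nf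
    _ ≤ ENNReal.ofReal (r ^ (-k) * birkhoffSum T ((ball p r).indicator 1) (2 ^ i) x) := by
      gcongr
    _ ≤ birkhoffS T (poleObservable p k) (2 ^ i) x :=
      ofReal_rpow_neg_mul_birkhoffSum_indicator_ball_le hr hk _ _
    _ ≤ birkhoffS T (poleObservable p k) n x :=
      birkhoffS_mono T _ x (Nat.pow_log_le_self 2 hn0)

end LowerBound

theorem theorem3_general {X : Type*} [MetricSpace X] [MeasurableSpace X] [BorelSpace X] {T : X → X}
    {μ : Measure X} [IsProbabilityMeasure μ] (hT : MeasurePreserving T μ μ)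
    (hA : ExpDecayLipschitz T μ) {p : X} {d : ℝ} (hd : 0 < d) (hup : UpperRegularAt μ d p)
    (hlow : LowerRegularAt μ d p) (k : ℝ) :
    (d < k → ∀ ε : ℝ, 0 < ε → ∀ᵐ x ∂μ,
      limsup (fun n : ℕ => birkhoffS T (poleObservable p k) n x /
        ENNReal.ofReal ((n : ℝ) ^ (k / d) * Real.log n ^ (k / d + ε))) atTop = 0) ∧
    (0 < k → ∀ a : ℝ, 0 < a → ∀ᵐ x ∂μ,
      1 < liminf (fun n : ℕ => birkhoffS T (poleObservable p k) n x /
        ENNReal.ofReal ((n : ℝ) ^ (k / d) * Real.exp (-(Real.log n ^ a)) ^ (k / d))) atTop) ∧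
    (0 ≤ k → ∃ a : ℝ, 0 < a ∧ ∀ᵐ x ∂μ,
      ENNReal.ofReal a <
        liminf (fun n : ℕ => birkhoffS T (poleObservable p k) n x / (n : ℝ≥0∞)) atTop) := by
  refine ⟨fun hk ε hε => ?_, fun hk a ha => hA.ae_one_lt_liminf_birkhoffS_div hT hd hlow hk ha,
    fun hk => hA.exists_ae_lt_liminf_birkhoffS_div hT p hk⟩
  have k_pos := hd.trans hk
  filter_upwards [ae_tendsto_birkhoffS_div_of_memWeakLp hT (measurable_poleObservable p k)
    (div_pos hd k_pos) ((div_lt_one k_pos).2 hk) (memWeakLp_poleObservable hd.le hup k_pos) hε]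
    with x hx
  rw [inv_div] at hx
  exact hx.limsup_eq

/-- `X` is a Riemannian manifold (possibly with boundary or corners) of dimension `D ≥ 1` with its
Riemannian distance, `μHE[D]` (the `D`-dimensional Hausdorff measure of that distance, normalized
to be Lebesgue measure on Euclidean space) is its Riemannian volume, and `h` is the density of the
invariant measure `μ` with respect to it. -/
theorem theorem3
    {E : Type*} [NormedAddCommGroup E] [NormedSpace ℝ E] [FiniteDimensional ℝ E]
    {H : Type*} [TopologicalSpace H] (I : ModelWithCorners ℝ E H)
    {X : Type*} [MetricSpace X] [ChartedSpace H X] [IsManifold I 1 X]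
    [RiemannianBundle (fun x : X => TangentSpace I x)]
    [IsContinuousRiemannianBundle E (fun x : X => TangentSpace I x)]
    [IsRiemannianManifold I X]
    [MeasurableSpace X] [BorelSpace X]
    (D : ℕ) (hD : Module.finrank ℝ E = D) (hD1 : 1 ≤ D)
    (T : X → X) (μ : Measure X) [IsProbabilityMeasure μ] (hT : Ergodic T μ)
    (hA : ExpDecayLipschitz T μ) (hB : ThinAnnuli μ)
    (h : X → ℝ≥0∞) (hh : Measurable h) (hμ : μ = (μHE[D] : Measure X).withDensity h)
    (p : X) (hp : DensityBoundedAt (μHE[D] : Measure X) h p) (k : ℝ) :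
    ((D : ℝ) < k → ∀ ε : ℝ, 0 < ε → ∀ᵐ x ∂μ,
      limsup (fun n : ℕ => birkhoffS T (poleObservable p k) n x /
        ENNReal.ofReal ((n : ℝ) ^ (k / D) * Real.log n ^ (k / D + ε))) atTop = 0 ∧
      1 < liminf (fun n : ℕ => birkhoffS T (poleObservable p k) n x /
        ENNReal.ofReal ((n : ℝ) ^ (k / D) *
          Real.exp (-(Real.log n ^ (1 / 2 + ε))) ^ (k / D))) atTop) ∧
    (k = D → ∃ a : ℝ, 0 < a ∧ ∀ᵐ x ∂μ,
      ENNReal.ofReal a <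
        liminf (fun n : ℕ => birkhoffS T (poleObservable p k) n x / (n : ℝ≥0∞)) atTop) := by
  subst hD hμ
  have d_pos : (0 : ℝ) < Module.finrank ℝ E := by exact_mod_cast hD1
  obtain ⟨limsup_eq, one_lt_liminf, lt_liminf⟩ := theorem3_general hT.toMeasurePreserving hA d_pos
    ((upperRegularAt_euclideanHausdorffMeasure I p).withDensity hp)
    ((lowerRegularAt_euclideanHausdorffMeasure I p).withDensity hp) k
  exact ⟨fun hk ε hε => (limsup_eq hk ε hε).and
    (one_lt_liminf (d_pos.trans hk) (1 / 2 + ε) (by positivity)),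
    fun hk => lt_liminf (hk ▸ d_pos.le)⟩
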